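/- Let $Z$ be an integrable real random variable, $X$ a random vector in $\mathbb R^m$ and $H:\mathbb R^d\times\mathbb R^m\to\mathbb R$ a measurable function such that $\mathbb E|H(\theta,X)|<\infty$, $\mathbb E(Z)=\mathbb E(H(\theta,X))$ and $v(\theta):=\mathrm{Var}(H(\theta,X))<\infty$ for all $\theta\in\mathbb R^d$. Let $(X_n)_{n\ge1}$ be an i.i.d. sequence following the law of $X$, let $\mathcal F_n=\sigma(X_1,\dots,X_n)$, and let $(\theta_n)_{n\ge0}$ be an $(\mathcal F_n)$-adapted sequence with values in $\mathbb R^d$ converging almost surely to a deterministic value $\theta_\infty\in\mathbb R^d$. Put $$\xi_n=\frac1n\sum_{i=1}^{n}H(\theta_{i-1},X_i),\qquad \sigma_n^2=\frac1n\sum_{i=0}^{n-1}H(\theta_i,X_{i+1})^2-\xi_n^2 .$$ Assume that there exists $\eta>0$ such that the function $\theta\mapsto\mathbb E\left(|H(\theta,X)|^{4+\eta}\right)$ is finite on $\mathbb R^d$ and continuous at $\theta_\infty$, and that $v$ is continuous at $\theta_\infty$. Then $\sigma_n^2\to v(\theta_\infty)$ almost surely. If moreover $v(\theta_\infty)>0$,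 then, with $\sigma_n=\sqrt{\sigma_n^2}$, $\frac{\sqrt n}{\sigma_n}\,(\xi_n-\mathbb E(Z))$ converges in law to $\mathcal N(0,1)$ as $n\to\infty$. -/

import Mathlib

open MeasureTheory ProbabilityTheory Filter Topology

noncomputable section

/-- The filtration `ℱ n = σ(X 1, …, X n)` generated by the samples `X 1, X 2, …`
(so `ℱ 0` is the trivial σ-algebra). The value `X 0` plays no role. -/
def sampleFiltration {Ω S : Type*} [mΩ : MeasurableSpace Ω] [mS : MeasurableSpace S]
    (X : ℕ → Ω → S) (hX : ∀ n, 1 ≤ n → Measurable (X n)) : Filtration ℕ mΩ where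
  seq n := ⨆ j ∈ Finset.Icc 1 n, MeasurableSpace.comap (X j) mS
  mono' _ _ hnm := biSup_mono fun _ hj =>
    Finset.mem_Icc.2 ⟨(Finset.mem_Icc.1 hj).1, (Finset.mem_Icc.1 hj).2.trans hnm⟩
  le' _ := iSup₂_le fun j hj => (hX j (Finset.mem_Icc.1 hj).1).comap_le

/-- The adaptive Monte Carlo estimator
`ξ n = (1 / n) * ∑_{i = 0}^{n - 1} H (θ i, X (i + 1))` (with `ξ 0 = 0`). -/
def adaptiveEstimator {Ω T S : Type*} (H : T → S → ℝ) (θ : ℕ → Ω → T) (X : ℕ → Ω → S)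
    (n : ℕ) (ω : Ω) : ℝ :=
  (1 / (n : ℝ)) * ∑ i ∈ Finset.range n, H (θ i ω) (X (i + 1) ω)

/-- The empirical variance
`σ n ^ 2 = (1 / n) * ∑_{i = 0}^{n - 1} H (θ i, X (i + 1)) ^ 2 - ξ n ^ 2`. -/
def empiricalVariance {Ω T S : Type*} (H : T → S → ℝ) (θ : ℕ → Ω → T) (X : ℕ → Ω → S)
    (n : ℕ) (ω : Ω) : ℝ :=
  (1 / (n : ℝ)) * ∑ i ∈ Finset.range n, H (θ i ω) (X (i + 1) ω) ^ 2
    - adaptiveEstimator H θ X n ω ^ 2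

/-- The function `v θ = Var (H (θ, X))`. -/
def paramVariance {Ω T S : Type*} [MeasurableSpace Ω] (H : T → S → ℝ) (X : Ω → S)
    (P : Measure Ω) (t : T) : ℝ :=
  variance (fun ω => H t (X ω)) P

/-- The absolute moment function `s_p θ = E |H (θ, X)| ^ p`. -/
def paramAbsMoment {Ω T S : Type*} [MeasurableSpace Ω] (H : T → S → ℝ) (X : Ω → S)
    (P : Measure Ω) (p : ℝ) (t : T) : ℝ :=
  ∫ ω, |H t (X ω)| ^ p ∂P

end

/-!
Write `Y i = H (θ i) (X (i + 1))`. Since `θ i` is `ℱ i`-measurable and `X (i + 1)` is independent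
of `ℱ i`, conditioning on `ℱ i` freezes `θ i`: for every `f`, the conditional expectation of
`f (θ i) (X (i + 1))` is the mean of `f t X` at `t = θ i` (`integral_comp_of_indepFun`). So `Y i`
has conditional mean `E Z` and conditional variance `v (θ i) → v θlim`.

*Localisation.* The moments of `H t X` are only controlled for `t` near `θlim`. Replacing `θ i` by
`θlim` whenever it leaves a small ball changes, almost surely, finitely many terms; this alters
neither the Cesàro means in the limit nor the sums normalised by `√n`. Along the modified parameters
the fourth moments are bounded.

*Variance.* The martingale `∑ (i + 1)⁻¹ (f (θ i) (X (i + 1)) - E [f (θ i) (X (i + 1)) | ℱ i])` is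
bounded in `L²` for `f = H` and `f = H ^ 2`, so it converges almost surely, and Kronecker's lemma
gives the strong law (`IsAdaptiveSampling.ae_tendsto_average`). Hence `ξ n → E Z`, and the average
of the squares tends to `v θlim + (E Z) ^ 2`.

*Central limit theorem.* Let `a k` be the characteristic function at `s = t / √n` of
`∑ i < k, (Y i - E Z)`. By freezing and a Taylor expansion, `a (k + 1) = r * a k + ε k`, where
`r = exp (- s ^ 2 v / 2)` and `|ε k| ≤ s ^ 2 / 2 * E |v (θ k) - v| + O(n ^ (-3 / 2))`. As `|r| ≤ 1`
the errors add up, and `|a n - r ^ n| ≤ ∑ k < n, |ε k| → 0`, the first term being a Cesàro mean of a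
null sequence, while `r ^ n = exp (- t ^ 2 v / 2)`
(`IsAdaptiveSampling.tendsto_integral_cexp_sum`). Lévy's continuity theorem and Slutsky's theorem
conclude.
-/

/-! ### Integrating out an independent variable -/

section Independence

variable {Ω T S : Type*} [MeasurableSpace Ω] [MeasurableSpace T] [MeasurableSpace S]
  {P : Measure Ω} [IsProbabilityMeasure P] {A : Ω → T} {B : Ω → S}

/-- Conditioning on `A` when `B` is independent of `A`: the variable `A` can be frozen while the
law of `B` is integrated out. -/
theorem integral_comp_of_indepFun {E : Type*} [NormedAddCommGroup E] [NormedSpace ℝ E]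
    (hA : Measurable A) (hB : Measurable B) (hAB : IndepFun A B P) {f : T → S → E}
    (hf : StronglyMeasurable (Function.uncurry f)) (hint : Integrable (fun ω => f (A ω) (B ω)) P) :
    ∫ ω, f (A ω) (B ω) ∂P = ∫ ω, ∫ x, f (A ω) x ∂(P.map B) ∂P := by
  have := Measure.isProbabilityMeasure_map (μ := P) hA.aemeasurable
  have := Measure.isProbabilityMeasure_map (μ := P) hB.aemeasurable
  have hlaw : P.map (fun ω => (A ω, B ω)) = (P.map A).prod (P.map B) :=
    hAB.map_prod_eq_prod_map_map hA.aemeasurable hB.aemeasurable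
  have hAB' : Measurable fun ω => (A ω, B ω) := hA.prodMk hB
  have hint' : Integrable (Function.uncurry f) ((P.map A).prod (P.map B)) := by
    rw [← hlaw]
    exact (integrable_map_measure hf.aestronglyMeasurable hAB'.aemeasurable).2 hint
  calc ∫ ω, f (A ω) (B ω) ∂P
      = ∫ z, Function.uncurry f z ∂(P.map fun ω => (A ω, B ω)) :=
        (integral_map hAB'.aemeasurable hf.aestronglyMeasurable).symm
    _ = ∫ t, ∫ x, f t x ∂(P.map B) ∂(P.map A) := by rw [hlaw, integral_prod _ hint']; rfl
    _ = ∫ ω, ∫ x, f (A ω) x ∂(P.map B) ∂P :=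
        integral_map hA.aemeasurable hf.integral_prod_right.aestronglyMeasurable

/-- A bound on the absolute moments of `f t B` that is uniform in `t` makes `f A B` integrable. -/
theorem integrable_comp_of_indepFun (hA : Measurable A) (hB : Measurable B)
    (hAB : IndepFun A B P) {f : T → S → ℝ} (hf : Measurable (Function.uncurry f))
    (hint : ∀ t, Integrable (f t) (P.map B)) {C : ℝ} (hC : ∀ t, ∫ x, |f t x| ∂(P.map B) ≤ C) :
    Integrable (fun ω => f (A ω) (B ω)) P := by
  have := Measure.isProbabilityMeasure_map (μ := P) hA.aemeasurable
  have := Measure.isProbabilityMeasure_map (μ := P) hB.aemeasurable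
  have hlaw : P.map (fun ω => (A ω, B ω)) = (P.map A).prod (P.map B) :=
    hAB.map_prod_eq_prod_map_map hA.aemeasurable hB.aemeasurable
  have hAB' : Measurable fun ω => (A ω, B ω) := hA.prodMk hB
  refine (integrable_map_measure hf.aestronglyMeasurable hAB'.aemeasurable).1 ?_
  rw [hlaw, integrable_prod_iff hf.aestronglyMeasurable]
  refine ⟨ae_of_all _ hint, Integrable.of_bound (C := C)
    hf.norm.stronglyMeasurable.integral_prod_right.aestronglyMeasurable (ae_of_all _ fun t => ?_)⟩
  rw [Real.norm_of_nonneg (integral_nonneg fun x => norm_nonneg _)]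
  exact hC t

theorem integral_abs_comp_le_of_indepFun (hA : Measurable A) (hB : Measurable B)
    (hAB : IndepFun A B P) {f : T → S → ℝ} (hf : Measurable (Function.uncurry f))
    (hint : ∀ t, Integrable (f t) (P.map B)) {C : ℝ} (hC : ∀ t, ∫ x, |f t x| ∂(P.map B) ≤ C) :
    ∫ ω, |f (A ω) (B ω)| ∂P ≤ C := by
  have h := integral_comp_of_indepFun hA hB hAB (f := fun t x => |f t x|)
    hf.norm.stronglyMeasurable (integrable_comp_of_indepFun hA hB hAB hf hint hC).abs
  rw [h]
  calc ∫ ω, ∫ x, |f (A ω) x| ∂(P.map B) ∂P ≤ ∫ _, C ∂P := by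
        refine integral_mono_of_nonneg (ae_of_all _ fun ω => integral_nonneg fun x => abs_nonneg _)
          (integrable_const _) (ae_of_all _ fun ω => hC _)
    _ = C := by simp

end Independence

/-! ### Adaptive sampling -/

/-- The parameters `θ n` are `ℱ n`-measurable, and the sample `X (n + 1)` is revealed at time
`n + 1`, independent of `ℱ n` and of law `μ`. The value `X 0` plays no role. -/
structure IsAdaptiveSampling {Ω T S : Type*} {mΩ : MeasurableSpace Ω} [MeasurableSpace T]
    [mS : MeasurableSpace S] (ℱ : Filtration ℕ mΩ) (θ : ℕ → Ω → T) (X : ℕ → Ω → S)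
    (μ : Measure S) (P : Measure Ω) : Prop where
  measurable_param : ∀ n, Measurable[ℱ n] (θ n)
  measurable_sample : ∀ n, Measurable[ℱ (n + 1)] (X (n + 1))
  map_sample : ∀ n, P.map (X (n + 1)) = μ
  indep : ∀ n, Indep (ℱ n) (mS.comap (X (n + 1))) P

namespace IsAdaptiveSampling

variable {Ω T S : Type*} {mΩ : MeasurableSpace Ω} [MeasurableSpace T] [MeasurableSpace S]
  {ℱ : Filtration ℕ mΩ} {θ : ℕ → Ω → T} {X : ℕ → Ω → S} {μ : Measure S} {P : Measure Ω}

theorem measurable_param' (h : IsAdaptiveSampling ℱ θ X μ P) (n : ℕ) : Measurable (θ n) :=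
  (h.measurable_param n).mono (ℱ.le n) le_rfl

theorem measurable_sample' (h : IsAdaptiveSampling ℱ θ X μ P) (n : ℕ) : Measurable (X (n + 1)) :=
  (h.measurable_sample n).mono (ℱ.le _) le_rfl

theorem indepFun (h : IsAdaptiveSampling ℱ θ X μ P) (n : ℕ) {R : Type*} [MeasurableSpace R]
    {U : Ω → R} (hU : Measurable[ℱ n] U) : IndepFun U (X (n + 1)) P :=
  (IndepFun_iff_Indep _ _ _).2 (indep_of_indep_of_le_left (h.indep n) hU.comap_le)

theorem measurable_comp (h : IsAdaptiveSampling ℱ θ X μ P) {R : Type*} [MeasurableSpace R]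
    {g : T → S → R} (hg : Measurable (Function.uncurry g)) (n : ℕ) :
    Measurable[ℱ (n + 1)] fun ω => g (θ n ω) (X (n + 1) ω) :=
  hg.comp (((h.measurable_param n).mono (ℱ.mono n.le_succ) le_rfl).prodMk (h.measurable_sample n))

theorem measurable_comp' (h : IsAdaptiveSampling ℱ θ X μ P) {R : Type*} [MeasurableSpace R]
    {g : T → S → R} (hg : Measurable (Function.uncurry g)) (n : ℕ) :
    Measurable fun ω => g (θ n ω) (X (n + 1) ω) :=
  (h.measurable_comp hg n).mono (ℱ.le _) le_rfl

theorem measurable_sum (h : IsAdaptiveSampling ℱ θ X μ P) {g : T → S → ℝ}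
    (hg : Measurable (Function.uncurry g)) (c : ℕ → ℝ) (n : ℕ) :
    Measurable[ℱ n] fun ω => ∑ i ∈ Finset.range n, c i * g (θ i ω) (X (i + 1) ω) := by
  refine Finset.measurable_fun_sum _ fun i hi => ?_
  exact ((h.measurable_comp hg i).mono (ℱ.mono (Finset.mem_range.1 hi)) le_rfl).const_mul _

variable [IsProbabilityMeasure P]

theorem integrable_comp (h : IsAdaptiveSampling ℱ θ X μ P) {g : T → S → ℝ}
    (hg : Measurable (Function.uncurry g)) (hint : ∀ t, Integrable (g t) μ) {C : ℝ}
    (hC : ∀ t, ∫ x, |g t x| ∂μ ≤ C) (n : ℕ) :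
    Integrable (fun ω => g (θ n ω) (X (n + 1) ω)) P := by
  obtain rfl := h.map_sample n
  exact integrable_comp_of_indepFun (h.measurable_param' n) (h.measurable_sample' n)
    (h.indepFun n (h.measurable_param n)) hg hint hC

theorem integral_abs_comp_le (h : IsAdaptiveSampling ℱ θ X μ P) {g : T → S → ℝ}
    (hg : Measurable (Function.uncurry g)) (hint : ∀ t, Integrable (g t) μ) {C : ℝ}
    (hC : ∀ t, ∫ x, |g t x| ∂μ ≤ C) (n : ℕ) :
    ∫ ω, |g (θ n ω) (X (n + 1) ω)| ∂P ≤ C := by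
  obtain rfl := h.map_sample n
  exact integral_abs_comp_le_of_indepFun (h.measurable_param' n) (h.measurable_sample' n)
    (h.indepFun n (h.measurable_param n)) hg hint hC

/-- The conditional expectation of `g (θ n) (X (n + 1))` given `ℱ n` is
`∫ x, g (θ n) x ∂μ`, tested against an `ℱ n`-measurable weight. -/
theorem integral_mul_comp (h : IsAdaptiveSampling ℱ θ X μ P) {𝕜 : Type*} [RCLike 𝕜]
    {g : T → S → 𝕜} (hg : Measurable (Function.uncurry g)) (n : ℕ) {U : Ω → 𝕜}
    (hU : Measurable[ℱ n] U)
    (hint : Integrable (fun ω => U ω * g (θ n ω) (X (n + 1) ω)) P) :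
    ∫ ω, U ω * g (θ n ω) (X (n + 1) ω) ∂P = ∫ ω, U ω * ∫ x, g (θ n ω) x ∂μ ∂P := by
  have hA : Measurable[ℱ n] fun ω => (U ω, θ n ω) := hU.prodMk (h.measurable_param n)
  have hf : Measurable (Function.uncurry fun (p : 𝕜 × T) (x : S) => p.1 * g p.2 x) :=
    (measurable_fst.comp measurable_fst).mul
      (hg.comp ((measurable_snd.comp measurable_fst).prodMk measurable_snd))
  have := integral_comp_of_indepFun (f := fun (p : 𝕜 × T) x => p.1 * g p.2 x)
    (hA.mono (ℱ.le n) le_rfl) (h.measurable_sample' n) (h.indepFun n hA)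
    hf.stronglyMeasurable hint
  rw [this, h.map_sample n]
  simp_rw [integral_const_mul]

end IsAdaptiveSampling

/-! ### Strong law of large numbers -/

/-- Kronecker's lemma for the weights `1 / (n + 1)`. -/
theorem tendsto_average_of_tendsto_sum_div {u : ℕ → ℝ} {s : ℝ}
    (hu : Tendsto (fun n => ∑ i ∈ Finset.range n, ((i : ℝ) + 1)⁻¹ * u i) atTop (𝓝 s)) :
    Tendsto (fun n : ℕ => (n : ℝ)⁻¹ * ∑ i ∈ Finset.range n, u i) atTop (𝓝 0) := by
  set S : ℕ → ℝ := fun n => ∑ i ∈ Finset.range n, ((i : ℝ) + 1)⁻¹ * u i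
  -- summation by parts
  have key : ∀ n : ℕ, ∑ i ∈ Finset.range n, u i = n * S n - ∑ i ∈ Finset.range n, S i := by
    intro n
    induction n with
    | zero => simp
    | succ k ih =>
      have hk : (k : ℝ) + 1 ≠ 0 := by positivity
      have : S (k + 1) = S k + ((k : ℝ) + 1)⁻¹ * u k := Finset.sum_range_succ _ _
      rw [Finset.sum_range_succ, Finset.sum_range_succ, ih, this]
      push_cast
      field_simp
      ring
  have h := hu.sub hu.cesaro
  rw [sub_self] at h
  refine h.congr' ?_
  filter_upwards [eventually_gt_atTop 0] with n hn
  have hn' : (n : ℝ) ≠ 0 := by exact_mod_cast hn.ne'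
  rw [key n]
  field_simp

namespace IsAdaptiveSampling

variable {Ω T S : Type*} {mΩ : MeasurableSpace Ω} [MeasurableSpace T] [MeasurableSpace S]
  {ℱ : Filtration ℕ mΩ} {θ : ℕ → Ω → T} {X : ℕ → Ω → S} {μ : Measure S} {P : Measure Ω}
  [IsProbabilityMeasure P]

theorem memLp_two_comp (h : IsAdaptiveSampling ℱ θ X μ P) {g : T → S → ℝ}
    (hg : Measurable (Function.uncurry g)) (hint : ∀ t, Integrable (fun x => g t x ^ 2) μ) {C : ℝ}
    (hC : ∀ t, ∫ x, g t x ^ 2 ∂μ ≤ C) (n : ℕ) :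
    MemLp (fun ω => g (θ n ω) (X (n + 1) ω)) 2 P := by
  rw [memLp_two_iff_integrable_sq (h.measurable_comp' hg n).aestronglyMeasurable]
  exact h.integrable_comp (g := fun t x => g t x ^ 2) (hg.pow_const 2) hint
    (by simpa only [abs_pow, sq_abs] using hC) n

theorem integral_sq_comp_le (h : IsAdaptiveSampling ℱ θ X μ P) {g : T → S → ℝ}
    (hg : Measurable (Function.uncurry g)) (hint : ∀ t, Integrable (fun x => g t x ^ 2) μ) {C : ℝ}
    (hC : ∀ t, ∫ x, g t x ^ 2 ∂μ ≤ C) (n : ℕ) :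
    ∫ ω, g (θ n ω) (X (n + 1) ω) ^ 2 ∂P ≤ C := by
  simpa only [abs_pow, sq_abs] using
    h.integral_abs_comp_le (g := fun t x => g t x ^ 2) (hg.pow_const 2) hint
      (by simpa only [abs_pow, sq_abs] using hC) n

/-- Centred innovations are orthogonal to the past. -/
theorem integral_mul_comp_eq_zero (h : IsAdaptiveSampling ℱ θ X μ P) {g : T → S → ℝ}
    (hg : Measurable (Function.uncurry g)) (hg0 : ∀ t, ∫ x, g t x ∂μ = 0) (n : ℕ) {U : Ω → ℝ}
    (hU : Measurable[ℱ n] U)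
    (hint : Integrable (fun ω => U ω * g (θ n ω) (X (n + 1) ω)) P) :
    ∫ ω, U ω * g (θ n ω) (X (n + 1) ω) ∂P = 0 := by
  rw [h.integral_mul_comp hg n hU hint]
  simp [hg0]

theorem memLp_two_sum (h : IsAdaptiveSampling ℱ θ X μ P) {g : T → S → ℝ}
    (hg : Measurable (Function.uncurry g)) (hint : ∀ t, Integrable (fun x => g t x ^ 2) μ) {C : ℝ}
    (hC : ∀ t, ∫ x, g t x ^ 2 ∂μ ≤ C) (c : ℕ → ℝ) (n : ℕ) :
    MemLp (fun ω => ∑ i ∈ Finset.range n, c i * g (θ i ω) (X (i + 1) ω)) 2 P :=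
  memLp_finsetSum _ fun i _ => (h.memLp_two_comp hg hint hC i).const_mul _

theorem martingale_sum (h : IsAdaptiveSampling ℱ θ X μ P) {g : T → S → ℝ}
    (hg : Measurable (Function.uncurry g)) (hg0 : ∀ t, ∫ x, g t x ∂μ = 0)
    (hint : ∀ t, Integrable (fun x => g t x ^ 2) μ) {C : ℝ}
    (hC : ∀ t, ∫ x, g t x ^ 2 ∂μ ≤ C) (c : ℕ → ℝ) :
    Martingale (fun n ω => ∑ i ∈ Finset.range n, c i * g (θ i ω) (X (i + 1) ω)) ℱ P := by
  have hM := h.memLp_two_sum hg hint hC c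
  refine martingale_of_setIntegral_eq_succ (fun n => (h.measurable_sum hg c n).stronglyMeasurable)
    (fun n => (hM n).integrable one_le_two) fun n s hs => ?_
  have hW := (h.memLp_two_comp hg hint hC n).integrable one_le_two
  have hs' := ℱ.le n s hs
  simp_rw [Finset.sum_range_succ]
  rw [integral_add ((hM n).integrable one_le_two).integrableOn (hW.const_mul _).integrableOn,
    integral_const_mul]
  suffices ∫ ω in s, g (θ n ω) (X (n + 1) ω) ∂P = 0 by simp [this]
  have hind : ∀ ω, s.indicator (1 : Ω → ℝ) ω * g (θ n ω) (X (n + 1) ω) =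
      s.indicator (fun ω => g (θ n ω) (X (n + 1) ω)) ω := by
    intro ω
    by_cases hω : ω ∈ s <;> simp [hω]
  rw [← integral_indicator hs']
  simp_rw [← hind]
  refine h.integral_mul_comp_eq_zero hg hg0 n (stronglyMeasurable_one.indicator hs).measurable ?_
  simp_rw [hind]
  exact hW.indicator hs'

/-- The second moments of the orthogonal centred innovations add up. -/
theorem integral_sum_sq_le (h : IsAdaptiveSampling ℱ θ X μ P) {g : T → S → ℝ}
    (hg : Measurable (Function.uncurry g)) (hg0 : ∀ t, ∫ x, g t x ∂μ = 0)
    (hint : ∀ t, Integrable (fun x => g t x ^ 2) μ) {C : ℝ}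
    (hC : ∀ t, ∫ x, g t x ^ 2 ∂μ ≤ C) (c : ℕ → ℝ) (n : ℕ) :
    ∫ ω, (∑ i ∈ Finset.range n, c i * g (θ i ω) (X (i + 1) ω)) ^ 2 ∂P ≤
      ∑ i ∈ Finset.range n, c i ^ 2 * C := by
  induction n with
  | zero => simp
  | succ n ih =>
    have hM := h.memLp_two_sum hg hint hC c n
    have hW := h.memLp_two_comp hg hint hC n
    have hMW : Integrable (fun ω => (∑ i ∈ Finset.range n, c i * g (θ i ω) (X (i + 1) ω)) *
        g (θ n ω) (X (n + 1) ω)) P := hM.integrable_mul hW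
    have hexp : ∀ ω, (∑ i ∈ Finset.range (n + 1), c i * g (θ i ω) (X (i + 1) ω)) ^ 2 =
        ((∑ i ∈ Finset.range n, c i * g (θ i ω) (X (i + 1) ω)) ^ 2 +
        2 * c n * ((∑ i ∈ Finset.range n, c i * g (θ i ω) (X (i + 1) ω)) *
          g (θ n ω) (X (n + 1) ω))) + c n ^ 2 * g (θ n ω) (X (n + 1) ω) ^ 2 := by
      intro ω
      rw [Finset.sum_range_succ]
      ring
    simp_rw [hexp]
    have hadd : Integrable (fun ω => (∑ i ∈ Finset.range n, c i * g (θ i ω) (X (i + 1) ω)) ^ 2 +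
        2 * c n * ((∑ i ∈ Finset.range n, c i * g (θ i ω) (X (i + 1) ω)) *
          g (θ n ω) (X (n + 1) ω))) P := hM.integrable_sq.add (hMW.const_mul _)
    rw [integral_add hadd (hW.integrable_sq.const_mul _),
      integral_add hM.integrable_sq (hMW.const_mul _), integral_const_mul, integral_const_mul,
      h.integral_mul_comp_eq_zero hg hg0 n (h.measurable_sum hg c n) hMW, Finset.sum_range_succ]
    have := mul_le_mul_of_nonneg_left (h.integral_sq_comp_le hg hint hC n) (sq_nonneg (c n))
    linarith

/-- Strong law of large numbers for centred innovations with bounded conditional variances: the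
martingale `∑ (i + 1)⁻¹ g (θ i) (X (i + 1))` is bounded in `L²`, hence converges almost surely,
and Kronecker's lemma applies. -/
theorem ae_tendsto_average_zero (h : IsAdaptiveSampling ℱ θ X μ P) {g : T → S → ℝ}
    (hg : Measurable (Function.uncurry g)) (hg0 : ∀ t, ∫ x, g t x ∂μ = 0)
    (hint : ∀ t, Integrable (fun x => g t x ^ 2) μ) {C : ℝ}
    (hC : ∀ t, ∫ x, g t x ^ 2 ∂μ ≤ C) :
    ∀ᵐ ω ∂P, Tendsto (fun n : ℕ => (n : ℝ)⁻¹ *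
      ∑ i ∈ Finset.range n, g (θ i ω) (X (i + 1) ω)) atTop (𝓝 0) := by
  set c : ℕ → ℝ := fun i => ((i : ℝ) + 1)⁻¹
  have hC0 : 0 ≤ C :=
    (integral_nonneg fun ω => sq_nonneg _).trans (h.integral_sq_comp_le hg hint hC 0)
  have hsum : Summable fun i => c i ^ 2 * C := by
    have := (summable_nat_add_iff 1).2 (Real.summable_one_div_nat_pow.2 one_lt_two)
    refine Summable.mul_right C (this.congr fun i => ?_)
    simp [c]
  have hbdd : ∀ n, eLpNorm (fun ω => ∑ i ∈ Finset.range n, c i * g (θ i ω) (X (i + 1) ω)) 1 P ≤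
      ((1 + ∑' i, c i ^ 2 * C).toNNReal : ENNReal) := by
    intro n
    have hM := h.memLp_two_sum hg hint hC c n
    have hM1 := hM.integrable one_le_two
    rw [eLpNorm_one_eq_lintegral_enorm, ← ofReal_integral_norm_eq_lintegral_enorm hM1]
    refine ENNReal.ofReal_le_ofReal ?_
    calc ∫ ω, ‖∑ i ∈ Finset.range n, c i * g (θ i ω) (X (i + 1) ω)‖ ∂P
        ≤ ∫ ω, (1 + (∑ i ∈ Finset.range n, c i * g (θ i ω) (X (i + 1) ω)) ^ 2) ∂P := by
          refine integral_mono hM1.norm ((integrable_const _).add hM.integrable_sq) fun ω => ?_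
          simp only [Real.norm_eq_abs]
          generalize ∑ i ∈ Finset.range n, c i * g (θ i ω) (X (i + 1) ω) = x
          nlinarith [sq_abs x, sq_nonneg (|x| - 1)]
      _ = 1 + ∫ ω, (∑ i ∈ Finset.range n, c i * g (θ i ω) (X (i + 1) ω)) ^ 2 ∂P := by
          rw [integral_add (integrable_const _) hM.integrable_sq]
          simp
      _ ≤ 1 + ∑' i, c i ^ 2 * C := by
          gcongr
          exact (h.integral_sum_sq_le hg hg0 hint hC c n).trans
            (hsum.sum_le_tsum _ fun i _ => by positivity)
  filter_upwards [(h.martingale_sum hg hg0 hint hC c).submartingale.exists_ae_tendsto_of_bdd hbdd]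
    with ω ⟨s, hs⟩
  exact tendsto_average_of_tendsto_sum_div hs

/-- Strong law of large numbers for innovations whose conditional means converge. -/
theorem ae_tendsto_average (h : IsAdaptiveSampling ℱ θ X μ P) [IsProbabilityMeasure μ]
    {g : T → S → ℝ} (hg : Measurable (Function.uncurry g))
    (hint : ∀ t, MemLp (g t) 2 μ) {C : ℝ}
    (hC : ∀ t, ∫ x, g t x ^ 2 ∂μ ≤ C) {a : ℝ}
    (ha : ∀ᵐ ω ∂P, Tendsto (fun n => ∫ x, g (θ n ω) x ∂μ) atTop (𝓝 a)) :
    ∀ᵐ ω ∂P, Tendsto (fun n : ℕ => (n : ℝ)⁻¹ *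
      ∑ i ∈ Finset.range n, g (θ i ω) (X (i + 1) ω)) atTop (𝓝 a) := by
  have hm : Measurable fun t => ∫ x, g t x ∂μ :=
    hg.stronglyMeasurable.integral_prod_right.measurable
  have hmem : ∀ t, MemLp (fun x => g t x - ∫ y, g t y ∂μ) 2 μ := fun t =>
    (hint t).sub (memLp_const _)
  have hzero := h.ae_tendsto_average_zero (g := fun t x => g t x - ∫ y, g t y ∂μ) (C := C)
    (hg.sub (hm.comp measurable_fst))
    (fun t => by
      rw [integral_sub ((hint t).integrable one_le_two) (integrable_const _)]; simp)
    (fun t => (hmem t).integrable_sq)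
    (fun t => by
      refine le_trans ?_ (hC t)
      rw [← variance_eq_integral (hint t).aestronglyMeasurable.aemeasurable]
      simpa using variance_le_expectation_sq (hint t).aestronglyMeasurable)
  filter_upwards [hzero, ha] with ω h0 h1
  have := h0.add h1.cesaro
  rw [zero_add] at this
  refine this.congr fun n => ?_
  rw [← mul_add, ← Finset.sum_add_distrib]
  simp

end IsAdaptiveSampling

/-! ### Central limit theorem -/

theorem norm_cexp_mul_I_sub_taylor_two_le (y : ℝ) :
    ‖Complex.exp (y * Complex.I) - (1 + y * Complex.I - (y : ℂ) ^ 2 / 2)‖ ≤ 4 * |y| ^ 3 := by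
  have hn : ‖(y : ℂ) * Complex.I‖ = |y| := by simp
  rcases le_or_gt |y| 1 with hy | hy
  · have h := Complex.exp_bound (x := y * Complex.I) (hn.trans_le hy) (n := 3) (by norm_num)
    rw [hn] at h
    have hsum : ∑ m ∈ Finset.range 3, ((y : ℂ) * Complex.I) ^ m / (m.factorial : ℂ) =
        1 + y * Complex.I - (y : ℂ) ^ 2 / 2 := by
      simp [Finset.sum_range_succ, Nat.factorial, mul_pow, Complex.I_sq]
      ring
    rw [hsum] at h
    refine h.trans ?_
    have : 0 ≤ |y| ^ 3 := by positivity
    norm_num [Nat.factorial]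
    linarith
  · -- for large `y` each of the four terms is at most `|y| ^ 3`
    have h1 : ‖Complex.exp (y * Complex.I)‖ = 1 := Complex.norm_exp_ofReal_mul_I y
    have h2 : ‖(y : ℂ) ^ 2 / 2‖ = |y| ^ 2 / 2 := by simp
    have h3 := norm_sub_le (Complex.exp (y * Complex.I)) (1 + y * Complex.I - (y : ℂ) ^ 2 / 2)
    have h4 := norm_sub_le (1 + (y : ℂ) * Complex.I) ((y : ℂ) ^ 2 / 2)
    have h5 := norm_add_le (1 : ℂ) ((y : ℂ) * Complex.I)
    rw [norm_one, hn] at h5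
    have h6 : (1 : ℝ) ≤ |y| ^ 3 := one_le_pow₀ hy.le
    have h7 : |y| ≤ |y| ^ 3 := le_self_pow₀ hy.le (by norm_num)
    have h8 : |y| ^ 2 ≤ |y| ^ 3 := pow_le_pow_right₀ hy.le (by norm_num)
    linarith

theorem abs_exp_neg_sub_one_sub_le {x : ℝ} (hx : 0 ≤ x) :
    |Real.exp (-x) - (1 - x)| ≤ x ^ 2 / 2 := by
  have h1 := Real.add_one_le_exp (-x)
  have h2 := Real.quadratic_le_exp_of_nonneg hx
  have h3 : Real.exp (-x) * Real.exp x = 1 := by rw [← Real.exp_add]; simp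
  have h4 : 0 < Real.exp (-x) := Real.exp_pos _
  have h5 : Real.exp (-x) ≤ 1 - x + x ^ 2 / 2 := by
    have hpos : 0 < 1 + x + x ^ 2 / 2 := by positivity
    have h6 : Real.exp (-x) * (1 + x + x ^ 2 / 2) ≤ 1 := by
      simpa only [h3] using mul_le_mul_of_nonneg_left h2 h4.le
    -- `(1 - x + x ^ 2 / 2) * (1 + x + x ^ 2 / 2) = 1 + x ^ 4 / 4`
    have h7 : Real.exp (-x) * (1 + x + x ^ 2 / 2) ≤
        (1 - x + x ^ 2 / 2) * (1 + x + x ^ 2 / 2) := by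
      nlinarith [sq_nonneg (x ^ 2)]
    exact le_of_mul_le_mul_right h7 hpos
  rw [abs_le]
  constructor <;> nlinarith [sq_nonneg x]

/-- Comparison of the characteristic function of a centred variable with that of a Gaussian, in
terms of the difference of the variances and of the third absolute moment. -/
theorem norm_integral_cexp_sub_exp_le {S : Type*} [MeasurableSpace S] {μ : Measure S}
    [IsProbabilityMeasure μ] {f : S → ℝ} (hf : MemLp f 3 μ) (hf0 : ∫ x, f x ∂μ = 0)
    {C : ℝ} (hC : ∫ x, |f x| ^ 3 ∂μ ≤ C) {v : ℝ} (hv : 0 ≤ v) (s : ℝ) :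
    ‖∫ x, Complex.exp ((s * f x : ℝ) * Complex.I) ∂μ - (Real.exp (-(s ^ 2 * v / 2)) : ℂ)‖ ≤
      s ^ 2 / 2 * |∫ x, f x ^ 2 ∂μ - v| + (4 * |s| ^ 3 * C + (s ^ 2 * v / 2) ^ 2 / 2) := by
  have hf1 : Integrable f μ := hf.integrable (by norm_num)
  have hf2 : Integrable (fun x => f x ^ 2) μ := (hf.mono_exponent (by norm_num)).integrable_sq
  have hf3 : Integrable (fun x => |f x| ^ 3) μ := by
    simpa using hf.integrable_norm_pow (p := 3) (by norm_num)
  have hexp : Integrable (fun x => Complex.exp ((s * f x : ℝ) * Complex.I)) μ := by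
    refine Integrable.of_bound (C := 1) ?_ (ae_of_all _ fun x => ?_)
    · have := hf.aestronglyMeasurable.aemeasurable
      exact (by fun_prop : AEMeasurable _ μ).aestronglyMeasurable
    · rw [Complex.norm_exp_ofReal_mul_I]
  have hlin : Integrable (fun x => 1 + ((s * f x : ℝ) : ℂ) * Complex.I) μ :=
    (integrable_const _).add ((hf1.const_mul s).ofReal.mul_const _)
  have hquad : Integrable (fun x => ((s * f x : ℝ) : ℂ) ^ 2 / 2) μ := by
    have : Integrable (fun x => ((s ^ 2 / 2 * f x ^ 2 : ℝ) : ℂ)) μ := (hf2.const_mul _).ofReal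
    refine this.congr (ae_of_all _ fun x => ?_)
    push_cast
    ring
  have hT : ∫ x, (1 + ((s * f x : ℝ) : ℂ) * Complex.I - ((s * f x : ℝ) : ℂ) ^ 2 / 2) ∂μ =
      ((1 - s ^ 2 / 2 * ∫ x, f x ^ 2 ∂μ : ℝ) : ℂ) := by
    have h1 : ∫ x, ((s * f x : ℝ) : ℂ) * Complex.I ∂μ = 0 := by
      rw [integral_mul_const, integral_complex_ofReal, integral_const_mul, hf0]
      simp
    have h2 : ∫ x, ((s * f x : ℝ) : ℂ) ^ 2 / 2 ∂μ = ((s ^ 2 / 2 * ∫ x, f x ^ 2 ∂μ : ℝ) : ℂ) := by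
      rw [← integral_const_mul, ← integral_complex_ofReal]
      refine integral_congr_ae (ae_of_all _ fun x => ?_)
      push_cast
      ring
    rw [integral_sub hlin hquad, integral_add (integrable_const _)
      ((hf1.const_mul s).ofReal.mul_const _), h1, h2]
    simp
  have hA : ‖∫ x, Complex.exp ((s * f x : ℝ) * Complex.I) ∂μ -
      ((1 - s ^ 2 / 2 * ∫ x, f x ^ 2 ∂μ : ℝ) : ℂ)‖ ≤ 4 * |s| ^ 3 * C := by
    have hTint : Integrable (fun x => 1 + ((s * f x : ℝ) : ℂ) * Complex.I -
        ((s * f x : ℝ) : ℂ) ^ 2 / 2) μ := hlin.sub hquad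
    rw [← hT, ← integral_sub hexp hTint]
    refine (norm_integral_le_of_norm_le (hf3.const_mul (4 * |s| ^ 3))
      (ae_of_all _ fun x => ?_)).trans ?_
    · refine (norm_cexp_mul_I_sub_taylor_two_le (s * f x)).trans_eq ?_
      rw [abs_mul]
      ring
    · rw [integral_const_mul]
      gcongr
  have hB : ‖((1 - s ^ 2 / 2 * ∫ x, f x ^ 2 ∂μ : ℝ) : ℂ) - (Real.exp (-(s ^ 2 * v / 2)) : ℂ)‖ ≤
      s ^ 2 / 2 * |∫ x, f x ^ 2 ∂μ - v| + (s ^ 2 * v / 2) ^ 2 / 2 := by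
    rw [← Complex.ofReal_sub, Complex.norm_real, Real.norm_eq_abs]
    have h1 := abs_exp_neg_sub_one_sub_le (x := s ^ 2 * v / 2) (by positivity)
    have h2 : |s ^ 2 / 2 * (∫ x, f x ^ 2 ∂μ - v)| = s ^ 2 / 2 * |∫ x, f x ^ 2 ∂μ - v| := by
      rw [abs_mul, abs_of_nonneg (by positivity)]
    rw [← h2]
    have h3 := abs_add_le (-(s ^ 2 / 2 * (∫ x, f x ^ 2 ∂μ - v)))
      (-(Real.exp (-(s ^ 2 * v / 2)) - (1 - s ^ 2 * v / 2)))
    rw [abs_neg, abs_neg] at h3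
    refine le_trans (le_of_eq ?_) (h3.trans (add_le_add_right h1 _))
    congr 1
    ring
  have := norm_sub_le_norm_sub_add_norm_sub
    (∫ x, Complex.exp ((s * f x : ℝ) * Complex.I) ∂μ)
    ((1 - s ^ 2 / 2 * ∫ x, f x ^ 2 ∂μ : ℝ) : ℂ) (Real.exp (-(s ^ 2 * v / 2)) : ℂ)
  linarith

/-- An approximate geometric recursion of ratio at most one accumulates its errors additively. -/
theorem norm_sub_pow_le_sum {a : ℕ → ℂ} {r : ℂ} {ε : ℕ → ℝ} (ha : a 0 = 1) (hr : ‖r‖ ≤ 1)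
    (h : ∀ k, ‖a (k + 1) - r * a k‖ ≤ ε k) (n : ℕ) :
    ‖a n - r ^ n‖ ≤ ∑ k ∈ Finset.range n, ε k := by
  induction n with
  | zero => simp [ha]
  | succ n ih =>
    rw [Finset.sum_range_succ]
    have h1 : a (n + 1) - r ^ (n + 1) = r * (a n - r ^ n) + (a (n + 1) - r * a n) := by ring
    rw [h1]
    refine (norm_add_le _ _).trans (add_le_add ?_ (h n))
    rw [norm_mul]
    exact (mul_le_of_le_one_left (norm_nonneg _) hr).trans ih

namespace IsAdaptiveSampling

variable {Ω T S : Type*} {mΩ : MeasurableSpace Ω} [MeasurableSpace T] [MeasurableSpace S]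
  {ℱ : Filtration ℕ mΩ} {θ : ℕ → Ω → T} {X : ℕ → Ω → S} {μ : Measure S} {P : Measure Ω}
  [IsProbabilityMeasure P] [IsProbabilityMeasure μ]

/-- One step of the recursion satisfied by the characteristic functions of the partial sums: adding
the innovation at time `k + 1` multiplies the characteristic function at `s` by that of a
Gaussian of variance `v`, up to an explicit error. -/
theorem norm_integral_cexp_sum_succ_sub_le (h : IsAdaptiveSampling ℱ θ X μ P) {g : T → S → ℝ}
    (hg : Measurable (Function.uncurry g)) (hg3 : ∀ t, MemLp (g t) 3 μ)
    (hg0 : ∀ t, ∫ x, g t x ∂μ = 0) {C : ℝ} (hC : ∀ t, ∫ x, |g t x| ^ 3 ∂μ ≤ C)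
    {v : ℝ} (hv : 0 ≤ v) (k : ℕ)
    (hint : Integrable (fun ω => |∫ x, g (θ k ω) x ^ 2 ∂μ - v|) P) (s : ℝ) :
    ‖∫ ω, Complex.exp ((s * ∑ i ∈ Finset.range (k + 1), g (θ i ω) (X (i + 1) ω) : ℝ) *
          Complex.I) ∂P -
        (Real.exp (-(s ^ 2 * v / 2)) : ℂ) *
          ∫ ω, Complex.exp ((s * ∑ i ∈ Finset.range k, g (θ i ω) (X (i + 1) ω) : ℝ) *
            Complex.I) ∂P‖ ≤
      s ^ 2 / 2 * ∫ ω, |∫ x, g (θ k ω) x ^ 2 ∂μ - v| ∂P +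
        (4 * |s| ^ 3 * C + (s ^ 2 * v / 2) ^ 2 / 2) := by
  set r : ℂ := (Real.exp (-(s ^ 2 * v / 2)) : ℂ)
  set U : Ω → ℂ := fun ω =>
    Complex.exp ((s * ∑ i ∈ Finset.range k, g (θ i ω) (X (i + 1) ω) : ℝ) * Complex.I) with hU
  set φ : T → S → ℂ := fun t x => Complex.exp ((s * g t x : ℝ) * Complex.I) with hφ
  have hSk : Measurable[ℱ k] fun ω => ∑ i ∈ Finset.range k, g (θ i ω) (X (i + 1) ω) := by
    simpa using h.measurable_sum hg (fun _ => 1) k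
  have hUm : Measurable[ℱ k] U := by
    have : Measurable fun y : ℝ => Complex.exp ((s * y : ℝ) * Complex.I) := by fun_prop
    exact this.comp hSk
  have hUm' : Measurable U := hUm.mono (ℱ.le k) le_rfl
  have hUn : ∀ ω, ‖U ω‖ = 1 := fun ω => Complex.norm_exp_ofReal_mul_I _
  have hφm : Measurable (Function.uncurry φ) := by
    have : Measurable fun y : ℝ => Complex.exp ((s * y : ℝ) * Complex.I) := by fun_prop
    exact this.comp hg
  have hφn : ∀ t x, ‖φ t x‖ = 1 := fun t x => Complex.norm_exp_ofReal_mul_I _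
  have hΦm : Measurable fun t => ∫ x, φ t x ∂μ :=
    hφm.stronglyMeasurable.integral_prod_right.measurable
  have hΦn : ∀ t, ‖∫ x, φ t x ∂μ‖ ≤ 1 := fun t => by
    simpa using norm_integral_le_of_norm_le_const (μ := μ) (ae_of_all _ fun x => (hφn t x).le)
  have hUint : Integrable U P := Integrable.of_bound hUm'.aestronglyMeasurable 1
    (ae_of_all _ fun ω => (hUn ω).le)
  have hUφ : Integrable (fun ω => U ω * φ (θ k ω) (X (k + 1) ω)) P :=
    Integrable.of_bound (hUm'.mul (h.measurable_comp' hφm k)).aestronglyMeasurable 1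
      (ae_of_all _ fun ω => by rw [norm_mul, hUn, hφn, one_mul])
  have hUΦ : Integrable (fun ω => U ω * ∫ x, φ (θ k ω) x ∂μ) P :=
    Integrable.of_bound
      (hUm'.mul (hΦm.comp (h.measurable_param' k))).aestronglyMeasurable 1
      (ae_of_all _ fun ω => by rw [norm_mul, hUn, one_mul]; exact hΦn _)
  have hsucc : ∀ ω, Complex.exp ((s * ∑ i ∈ Finset.range (k + 1), g (θ i ω) (X (i + 1) ω) : ℝ) *
      Complex.I) = U ω * φ (θ k ω) (X (k + 1) ω) := by
    intro ω
    rw [hU, hφ, Finset.sum_range_succ, ← Complex.exp_add]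
    push_cast
    ring_nf
  simp_rw [hsucc]
  rw [h.integral_mul_comp hφm k hUm hUφ, ← integral_const_mul,
    ← integral_sub hUΦ (hUint.const_mul r), ← integral_const_mul]
  have hbound : Integrable (fun ω => s ^ 2 / 2 * |∫ x, g (θ k ω) x ^ 2 ∂μ - v| +
      (4 * |s| ^ 3 * C + (s ^ 2 * v / 2) ^ 2 / 2)) P :=
    (hint.const_mul _).add (integrable_const _)
  refine (norm_integral_le_of_norm_le hbound (ae_of_all _ fun ω => ?_)).trans_eq ?_
  · have : U ω * ∫ x, φ (θ k ω) x ∂μ - r * U ω = U ω * (∫ x, φ (θ k ω) x ∂μ - r) := by ring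
    rw [this, norm_mul, hUn, one_mul]
    exact norm_integral_cexp_sub_exp_le (hg3 _) (hg0 _) (hC _) hv s
  · rw [integral_add (hint.const_mul _) (integrable_const _)]
    simp

/-- **Central limit theorem** for centred innovations with bounded conditional third moments, whose
conditional variances converge almost surely to a constant, in terms of characteristic functions. -/
theorem tendsto_integral_cexp_sum (h : IsAdaptiveSampling ℱ θ X μ P) {g : T → S → ℝ}
    (hg : Measurable (Function.uncurry g)) (hg3 : ∀ t, MemLp (g t) 3 μ)
    (hg0 : ∀ t, ∫ x, g t x ∂μ = 0) {C : ℝ} (hC : ∀ t, ∫ x, |g t x| ^ 3 ∂μ ≤ C)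
    {v : ℝ} (hv : 0 ≤ v)
    (hlim : ∀ᵐ ω ∂P, Tendsto (fun n => ∫ x, g (θ n ω) x ^ 2 ∂μ) atTop (𝓝 v)) (t : ℝ) :
    Tendsto (fun n : ℕ => ∫ ω, Complex.exp
        ((t / √n * ∑ i ∈ Finset.range n, g (θ i ω) (X (i + 1) ω) : ℝ) * Complex.I) ∂P)
      atTop (𝓝 (Real.exp (-(t ^ 2 * v / 2)) : ℂ)) := by
  set V : T → ℝ := fun t => ∫ x, g t x ^ 2 ∂μ with hVdef
  have hVm : Measurable V := (hg.pow_const 2).stronglyMeasurable.integral_prod_right.measurable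
  have hVle : ∀ t, V t ≤ 1 + C := by
    intro t
    have h3 : Integrable (fun x => |g t x| ^ 3) μ := by
      simpa using (hg3 t).integrable_norm_pow (p := 3) (by norm_num)
    calc V t ≤ ∫ x, (1 + |g t x| ^ 3) ∂μ := by
          refine integral_mono ((hg3 t).mono_exponent (by norm_num)).integrable_sq
            ((integrable_const _).add h3) fun x => ?_
          simp only
          rw [← sq_abs]
          have := abs_nonneg (g t x)
          generalize |g t x| = y at *
          nlinarith [mul_nonneg this (sq_nonneg (y - 1)), sq_nonneg (y - 1)]
      _ = 1 + ∫ x, |g t x| ^ 3 ∂μ := by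
          rw [integral_add (integrable_const _) h3]; simp
      _ ≤ 1 + C := by gcongr; exact hC t
  have hVnn : ∀ t, 0 ≤ V t := fun t => integral_nonneg fun x => sq_nonneg _
  have hVb : ∀ t, |V t - v| ≤ 1 + C + v := fun t => by
    rw [abs_le]; constructor <;> linarith [hVle t, hVnn t]
  have hVabsm : ∀ n, Measurable fun ω => |V (θ n ω) - v| := fun n =>
    ((hVm.comp (h.measurable_param' n)).sub_const v).norm
  have hVint : ∀ n, Integrable (fun ω => |V (θ n ω) - v|) P := fun n =>
    Integrable.of_bound (hVabsm n).aestronglyMeasurable (1 + C + v)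
      (ae_of_all _ fun ω => by simpa using hVb _)
  -- the conditional variances converge in `L¹`, by dominated convergence
  have hδ : Tendsto (fun n => ∫ ω, |V (θ n ω) - v| ∂P) atTop (𝓝 0) := by
    have := tendsto_integral_of_dominated_convergence (μ := P)
      (F := fun n ω => |V (θ n ω) - v|) (f := fun _ => 0) (fun _ => 1 + C + v)
      (fun n => (hVabsm n).aestronglyMeasurable) (integrable_const _)
      (fun n => ae_of_all _ fun ω => by simpa using hVb _)
      (by
        filter_upwards [hlim] with ω hω
        simpa using (hω.sub_const v).abs)
    simpa using this
  have hmain : ∀ n : ℕ, 0 < n → ‖∫ ω, Complex.exp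
        ((t / √n * ∑ i ∈ Finset.range n, g (θ i ω) (X (i + 1) ω) : ℝ) * Complex.I) ∂P -
        (Real.exp (-(t ^ 2 * v / 2)) : ℂ)‖ ≤
      t ^ 2 / 2 * ((n : ℝ)⁻¹ * ∑ k ∈ Finset.range n, ∫ ω, |V (θ k ω) - v| ∂P) +
        (4 * |t| ^ 3 * C * (√n)⁻¹ + (t ^ 2 * v / 2) ^ 2 / 2 * (n : ℝ)⁻¹) := by
    intro n hn
    have hn0 : (0 : ℝ) < n := by exact_mod_cast hn
    set s : ℝ := t / √n with hs
    have hq : √(n : ℝ) ^ 2 = n := Real.sq_sqrt hn0.le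
    have hq0 : 0 < √(n : ℝ) := Real.sqrt_pos.2 hn0
    have hs2 : s ^ 2 = t ^ 2 / n := by rw [hs, div_pow, hq]
    have hs3 : n * |s| ^ 3 = |t| ^ 3 * (√(n : ℝ))⁻¹ := by
      rw [hs, abs_div, abs_of_pos hq0, div_pow]
      nth_rewrite 1 [← hq]
      field_simp
    have hrec := norm_sub_pow_le_sum
      (a := fun k => ∫ ω, Complex.exp
        ((s * ∑ i ∈ Finset.range k, g (θ i ω) (X (i + 1) ω) : ℝ) * Complex.I) ∂P)
      (r := (Real.exp (-(s ^ 2 * v / 2)) : ℂ)) (by simp)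
      (by
        rw [Complex.norm_real, Real.norm_of_nonneg (Real.exp_pos _).le, Real.exp_le_one_iff]
        have : 0 ≤ s ^ 2 * v / 2 := by positivity
        linarith)
      (fun k => h.norm_integral_cexp_sum_succ_sub_le hg hg3 hg0 hC hv k (hVint k) s) n
    have hr : (Real.exp (-(s ^ 2 * v / 2)) : ℂ) ^ n = (Real.exp (-(t ^ 2 * v / 2)) : ℂ) := by
      rw [← Complex.ofReal_pow, ← Real.exp_nat_mul, hs2]
      congr 2
      field_simp
    rw [hr] at hrec
    refine hrec.trans_eq ?_
    rw [Finset.sum_add_distrib, ← Finset.mul_sum, Finset.sum_const, Finset.card_range,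
      nsmul_eq_mul, hs2, mul_add]
    have e1 : (n : ℝ) * (4 * |s| ^ 3 * C) = 4 * |t| ^ 3 * C * (√(n : ℝ))⁻¹ := by
      linear_combination 4 * C * hs3
    rw [e1]
    simp only [hVdef]
    field_simp
  rw [tendsto_iff_norm_sub_tendsto_zero]
  have hinv : Tendsto (fun n : ℕ => (n : ℝ)⁻¹) atTop (𝓝 0) := tendsto_inv_atTop_nhds_zero_nat
  have hsq : Tendsto (fun n : ℕ => (√(n : ℝ))⁻¹) atTop (𝓝 0) :=
    tendsto_inv_atTop_zero.comp (Real.tendsto_sqrt_atTop.comp tendsto_natCast_atTop_atTop)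
  have hbd := (hδ.cesaro.const_mul (t ^ 2 / 2)).add
    ((hsq.const_mul (4 * |t| ^ 3 * C)).add (hinv.const_mul ((t ^ 2 * v / 2) ^ 2 / 2)))
  simp only [mul_zero, add_zero] at hbd
  refine tendsto_of_tendsto_of_tendsto_of_le_of_le' tendsto_const_nhds hbd
    (Eventually.of_forall fun n => norm_nonneg _) ?_
  filter_upwards [eventually_gt_atTop 0] with n hn using hmain n hn

/-- **Central limit theorem** for centred innovations with bounded conditional third moments, whose
conditional variances converge almost surely to a constant. -/
theorem tendstoInDistribution_sum (h : IsAdaptiveSampling ℱ θ X μ P) {g : T → S → ℝ}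
    (hg : Measurable (Function.uncurry g)) (hg3 : ∀ t, MemLp (g t) 3 μ)
    (hg0 : ∀ t, ∫ x, g t x ∂μ = 0) {C : ℝ} (hC : ∀ t, ∫ x, |g t x| ^ 3 ∂μ ≤ C)
    {v : ℝ} (hv : 0 < v)
    (hlim : ∀ᵐ ω ∂P, Tendsto (fun n => ∫ x, g (θ n ω) x ^ 2 ∂μ) atTop (𝓝 v)) :
    TendstoInDistribution (fun (n : ℕ) ω => (√v)⁻¹ * ((√n)⁻¹ *
        ∑ i ∈ Finset.range n, g (θ i ω) (X (i + 1) ω)))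
      atTop (id : ℝ → ℝ) (fun _ => P) (gaussianReal 0 1) where
  forall_aemeasurable n := by
    have := Finset.measurable_fun_sum (Finset.range n) fun i _ => h.measurable_comp' hg i
    exact ((this.const_mul _).const_mul _).aemeasurable
  aemeasurable_limit := aemeasurable_id
  tendsto := by
    refine ProbabilityMeasure.tendsto_iff_tendsto_charFun.2 fun t => ?_
    have hlimit : charFun ((gaussianReal 0 1).map id) t =
        (Real.exp (-((t / √v) ^ 2 * v / 2)) : ℂ) := by
      rw [Measure.map_id, charFun_gaussianReal, div_pow, Real.sq_sqrt hv.le]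
      push_cast
      congr 1
      have : (v : ℂ) ≠ 0 := by exact_mod_cast hv.ne'
      field_simp
      simp [sq]
    have hcf := h.tendsto_integral_cexp_sum hg hg3 hg0 hC hv.le hlim (t / √v)
    rw [← hlimit] at hcf
    refine hcf.congr fun n => ?_
    have hm := Finset.measurable_fun_sum (Finset.range n) fun i _ => h.measurable_comp' hg i
    simp only [ProbabilityMeasure.coe_mk]
    rw [charFun_apply_real, integral_map ((hm.const_mul _).const_mul _).aemeasurable (by fun_prop)]
    refine integral_congr_ae (ae_of_all _ fun ω => ?_)
    simp only
    congr 2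
    push_cast
    ring

end IsAdaptiveSampling

/-! ### The filtration generated by independent samples -/

theorem isAdaptiveSampling_sampleFiltration {Ω T S : Type*} [MeasurableSpace Ω]
    [MeasurableSpace T] [MeasurableSpace S] {P : Measure Ω} [IsProbabilityMeasure P]
    {X : ℕ → Ω → S} {θ : ℕ → Ω → T} {μ : Measure S} (hX : ∀ n, 1 ≤ n → Measurable (X n))
    (hindep : iIndepFun (fun n : ℕ => X (n + 1)) P) (hlaw : ∀ n, P.map (X (n + 1)) = μ)
    (hθ : Adapted (sampleFiltration X hX) θ) :
    IsAdaptiveSampling (sampleFiltration X hX) θ X μ P where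
  measurable_param := hθ
  measurable_sample n := by
    refine Measurable.mono (comap_measurable (X (n + 1))) ?_ le_rfl
    exact le_iSup₂_of_le (n + 1) (Finset.mem_Icc.2 ⟨by omega, le_rfl⟩) le_rfl
  map_sample := hlaw
  indep n := by
    have hi := (iIndepFun_iff_iIndep _ _ _).1 hindep
    have h := indep_iSup_of_disjoint (fun i => (hX (i + 1) (by omega)).comap_le) hi
      (S := {i | i < n}) (T := {n}) (by simp)
    refine indep_of_indep_of_le_left (indep_of_indep_of_le_right h ?_) ?_
    · exact le_iSup₂_of_le n (Set.mem_singleton n) le_rfl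
    · refine iSup₂_le fun j hj => ?_
      obtain ⟨h1, h2⟩ := Finset.mem_Icc.1 hj
      obtain ⟨i, rfl⟩ : ∃ i, j = i + 1 := ⟨j - 1, by omega⟩
      exact le_iSup₂_of_le (f := fun i (_ : i ∈ {i | i < n}) => MeasurableSpace.comap (X (i + 1)) _)
        i (by simpa using h2) le_rfl

/-! ### Consequences of bounded fourth moments -/

namespace IsAdaptiveSampling

variable {Ω T S : Type*} {mΩ : MeasurableSpace Ω} [MeasurableSpace T] [MeasurableSpace S]
  {ℱ : Filtration ℕ mΩ} {θ : ℕ → Ω → T} {X : ℕ → Ω → S} {μ : Measure S} {P : Measure Ω}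
  [IsProbabilityMeasure P] [IsProbabilityMeasure μ]

theorem ae_tendsto_average_of_fourth_moment_le (h : IsAdaptiveSampling ℱ θ X μ P)
    {H : T → S → ℝ} (hH : Measurable (Function.uncurry H)) (h4 : ∀ t, MemLp (H t) 4 μ) {C : ℝ}
    (hC : ∀ t, ∫ x, H t x ^ 4 ∂μ ≤ C) {M : ℝ} (hM : ∀ t, ∫ x, H t x ∂μ = M) :
    ∀ᵐ ω ∂P, Tendsto (fun n : ℕ => (n : ℝ)⁻¹ *
      ∑ i ∈ Finset.range n, H (θ i ω) (X (i + 1) ω)) atTop (𝓝 M) := by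
  have hi4 : ∀ t, Integrable (fun x => H t x ^ 4) μ := fun t => by
    simpa [Even.pow_abs (by decide : Even 4)] using
      (h4 t).integrable_norm_pow (p := 4) (by norm_num)
  refine h.ae_tendsto_average hH (fun t => (h4 t).mono_exponent (by norm_num)) (C := 1 + C)
    (fun t => ?_) (ae_of_all _ fun ω => by simp only [hM]; exact tendsto_const_nhds)
  calc ∫ x, H t x ^ 2 ∂μ ≤ ∫ x, (1 + H t x ^ 4) ∂μ := by
        refine integral_mono ((h4 t).mono_exponent (by norm_num)).integrable_sq
          ((integrable_const _).add (hi4 t)) fun x => ?_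
        simp only
        nlinarith [sq_nonneg (H t x ^ 2 - 1)]
    _ = 1 + ∫ x, H t x ^ 4 ∂μ := by
        rw [integral_add (integrable_const _) (hi4 t)]; simp
    _ ≤ 1 + C := by gcongr; exact hC t

theorem ae_tendsto_average_sq (h : IsAdaptiveSampling ℱ θ X μ P)
    {H : T → S → ℝ} (hH : Measurable (Function.uncurry H)) (h4 : ∀ t, MemLp (H t) 4 μ) {C : ℝ}
    (hC : ∀ t, ∫ x, H t x ^ 4 ∂μ ≤ C) {a : ℝ}
    (ha : ∀ᵐ ω ∂P, Tendsto (fun n => ∫ x, H (θ n ω) x ^ 2 ∂μ) atTop (𝓝 a)) :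
    ∀ᵐ ω ∂P, Tendsto (fun n : ℕ => (n : ℝ)⁻¹ *
      ∑ i ∈ Finset.range n, H (θ i ω) (X (i + 1) ω) ^ 2) atTop (𝓝 a) := by
  refine h.ae_tendsto_average (g := fun t x => H t x ^ 2) (hH.pow_const 2) (fun t => ?_)
    (C := C) (fun t => ?_) ha
  · have hm : AEStronglyMeasurable (fun x => H t x ^ 2) μ := (h4 t).aestronglyMeasurable.pow 2
    rw [memLp_two_iff_integrable_sq hm]
    have := (h4 t).integrable_norm_pow (p := 4) (by norm_num)
    refine this.congr (ae_of_all _ fun x => ?_)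
    simp only [Real.norm_eq_abs, Even.pow_abs (by decide : Even 4)]
    ring
  · refine le_trans (le_of_eq ?_) (hC t)
    congr 1
    ext x
    ring

theorem tendstoInDistribution_of_fourth_moment_le (h : IsAdaptiveSampling ℱ θ X μ P)
    {H : T → S → ℝ} (hH : Measurable (Function.uncurry H)) (h4 : ∀ t, MemLp (H t) 4 μ) {C : ℝ}
    (hC : ∀ t, ∫ x, H t x ^ 4 ∂μ ≤ C) {M : ℝ} (hM : ∀ t, ∫ x, H t x ∂μ = M) {v : ℝ} (hv : 0 < v)
    (hlim : ∀ᵐ ω ∂P, Tendsto (fun n => ∫ x, (H (θ n ω) x - M) ^ 2 ∂μ) atTop (𝓝 v)) :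
    TendstoInDistribution (fun (n : ℕ) ω => (√v)⁻¹ * ((√n)⁻¹ *
        ∑ i ∈ Finset.range n, (H (θ i ω) (X (i + 1) ω) - M)))
      atTop (id : ℝ → ℝ) (fun _ => P) (gaussianReal 0 1) := by
  have hi4 : ∀ t, Integrable (fun x => H t x ^ 4) μ := fun t => by
    simpa [Even.pow_abs (by decide : Even 4)] using
      (h4 t).integrable_norm_pow (p := 4) (by norm_num)
  have h3 : ∀ t, MemLp (fun x => H t x - M) 3 μ := fun t =>
    ((h4 t).mono_exponent (by norm_num)).sub (memLp_const M)
  refine h.tendstoInDistribution_sum (g := fun t x => H t x - M) (hH.sub_const M) h3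
    (fun t => ?_) (C := 4 * (1 + |M| ^ 3) + 4 * C) (fun t => ?_) hv hlim
  · rw [integral_sub ((h4 t).integrable (by norm_num)) (integrable_const _), hM t]
    simp
  · have hi3 : Integrable (fun x => |H t x - M| ^ 3) μ := by
      simpa using (h3 t).integrable_norm_pow (p := 3) (by norm_num)
    calc ∫ x, |H t x - M| ^ 3 ∂μ ≤ ∫ x, (4 * (1 + |M| ^ 3) + 4 * H t x ^ 4) ∂μ := by
          refine integral_mono hi3 ((integrable_const _).add ((hi4 t).const_mul _)) fun x => ?_
          simp only
          have h1 : |H t x - M| ^ 3 ≤ (|H t x| + |M|) ^ 3 := by gcongr; exact abs_sub _ _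
          have h2 := add_pow_le (abs_nonneg (H t x)) (abs_nonneg M) 3
          have h5 : |H t x| ^ 3 ≤ 1 + H t x ^ 4 := by
            rw [← Even.pow_abs (by decide : Even 4)]
            rcases le_total |H t x| 1 with hy | hy
            · have := pow_le_one₀ (n := 3) (abs_nonneg (H t x)) hy
              have : 0 ≤ |H t x| ^ 4 := by positivity
              linarith
            · have := pow_le_pow_right₀ hy (by norm_num : 3 ≤ 4)
              linarith
          norm_num at h2
          linarith
      _ = 4 * (1 + |M| ^ 3) + 4 * ∫ x, H t x ^ 4 ∂μ := by
          rw [integral_add (integrable_const _) ((hi4 t).const_mul _),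
            integral_const_mul 4 fun x => H t x ^ 4]
          simp
      _ ≤ _ := by gcongr; exact hC t

end IsAdaptiveSampling

/-! ### Localisation and Studentization -/

/-- Changing finitely many terms does not matter after division by a sequence tending to
infinity. -/
theorem tendsto_inv_mul_sum_sub_sum {u w b : ℕ → ℝ} (h : u =ᶠ[atTop] w)
    (hb : Tendsto b atTop atTop) :
    Tendsto (fun n => (b n)⁻¹ * (∑ i ∈ Finset.range n, u i - ∑ i ∈ Finset.range n, w i))
      atTop (𝓝 0) := by
  obtain ⟨N, hN⟩ := eventually_atTop.1 h
  have := (tendsto_inv_atTop_zero.comp hb).mul_const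
    (∑ i ∈ Finset.range N, (u i - w i))
  rw [zero_mul] at this
  refine this.congr' ?_
  filter_upwards [eventually_ge_atTop N] with n hn
  rw [← Finset.sum_sub_distrib, Function.comp_apply]
  congr 1
  refine Finset.sum_subset (Finset.range_mono hn) fun i _ hi => ?_
  rw [hN i (by simpa using hi), sub_self]

theorem tendsto_average_congr {u w : ℕ → ℝ} {a : ℝ} (h : u =ᶠ[atTop] w)
    (hw : Tendsto (fun n : ℕ => (n : ℝ)⁻¹ * ∑ i ∈ Finset.range n, w i) atTop (𝓝 a)) :
    Tendsto (fun n : ℕ => (n : ℝ)⁻¹ * ∑ i ∈ Finset.range n, u i) atTop (𝓝 a) := by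
  have := (tendsto_inv_mul_sum_sub_sum h tendsto_natCast_atTop_atTop).add hw
  rw [zero_add] at this
  exact this.congr fun n => by ring

/-- Slutsky's theorem for an affine transformation with random coefficients tending almost surely
to the identity. -/
theorem tendstoInDistribution_mul_add {Ω Ω' : Type*} [MeasurableSpace Ω] [MeasurableSpace Ω']
    {P : Measure Ω} [IsProbabilityMeasure P] {P' : Measure Ω'} [IsProbabilityMeasure P']
    {Y c r : ℕ → Ω → ℝ} {Z : Ω' → ℝ} (hY : TendstoInDistribution Y atTop Z (fun _ => P) P')
    (hc : ∀ n, Measurable (c n)) (hr : ∀ n, Measurable (r n))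
    (hc1 : ∀ᵐ ω ∂P, Tendsto (fun n => c n ω) atTop (𝓝 1))
    (hr0 : ∀ᵐ ω ∂P, Tendsto (fun n => r n ω) atTop (𝓝 0)) :
    TendstoInDistribution (fun n ω => c n ω * Y n ω + r n ω) atTop Z (fun _ => P) P' := by
  have hcr : TendstoInMeasure P (fun n ω => (c n ω, r n ω)) atTop fun _ => ((1 : ℝ), (0 : ℝ)) := by
    refine tendstoInMeasure_of_tendsto_ae
      (fun n => ((hc n).prodMk (hr n)).aestronglyMeasurable) ?_
    filter_upwards [hc1, hr0] with ω h1 h0 using h1.prodMk_nhds h0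
  have := hY.continuous_comp_prodMk_of_tendstoInMeasure_const
    (g := fun z : ℝ × (ℝ × ℝ) => z.2.1 * z.1 + z.2.2) (by fun_prop) hcr
    (fun n => ((hc n).prodMk (hr n)).aemeasurable)
  simpa using this

namespace IsAdaptiveSampling

variable {Ω T S : Type*} {mΩ : MeasurableSpace Ω} [MeasurableSpace T] [MeasurableSpace S]
  {ℱ : Filtration ℕ mΩ} {θ : ℕ → Ω → T} {X : ℕ → Ω → S} {μ : Measure S} {P : Measure Ω}
  {H : T → S → ℝ}

theorem measurable_adaptiveEstimator (h : IsAdaptiveSampling ℱ θ X μ P)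
    (hH : Measurable (Function.uncurry H)) (n : ℕ) : Measurable (adaptiveEstimator H θ X n) :=
  (Finset.measurable_fun_sum _ fun i _ => h.measurable_comp' hH i).const_mul _

theorem measurable_empiricalVariance (h : IsAdaptiveSampling ℱ θ X μ P)
    (hH : Measurable (Function.uncurry H)) (n : ℕ) : Measurable (empiricalVariance H θ X n) :=
  ((Finset.measurable_fun_sum _ fun i _ => (h.measurable_comp' hH i).pow_const 2).const_mul _).sub
    ((h.measurable_adaptiveEstimator hH n).pow_const 2)

variable [IsProbabilityMeasure P] [IsProbabilityMeasure μ]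

/-- Studentized central limit theorem: the fourth moments need only be bounded along a measurable
modification `p` of the parameters that almost surely changes finitely many of them. -/
theorem tendsto_empiricalVariance_and_tendstoInDistribution (h : IsAdaptiveSampling ℱ θ X μ P)
    (hH : Measurable (Function.uncurry H)) (h4 : ∀ t, MemLp (H t) 4 μ) {M : ℝ}
    (hM : ∀ t, ∫ x, H t x ∂μ = M) {p : T → T} (hp : Measurable p) {C : ℝ}
    (hC : ∀ t, ∫ x, H (p t) x ^ 4 ∂μ ≤ C) (hpθ : ∀ᵐ ω ∂P, ∀ᶠ n in atTop, p (θ n ω) = θ n ω)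
    {v : ℝ} (hlim : ∀ᵐ ω ∂P, Tendsto (fun n => Var[H (θ n ω); μ]) atTop (𝓝 v)) :
    (∀ᵐ ω ∂P, Tendsto (fun n => empiricalVariance H θ X n ω) atTop (𝓝 v)) ∧
    (0 < v → TendstoInDistribution (fun (n : ℕ) (ω : Ω) =>
        √(n : ℝ) / √(empiricalVariance H θ X n ω) * (adaptiveEstimator H θ X n ω - M))
      atTop (id : ℝ → ℝ) (fun _ => P) (gaussianReal 0 1)) := by
  have hG : Measurable (Function.uncurry fun t x => H (p t) x) :=
    hH.comp ((hp.comp measurable_fst).prodMk measurable_snd)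
  have hG4 : ∀ t, MemLp (fun x => H (p t) x) 4 μ := fun t => h4 (p t)
  have hGM : ∀ t, ∫ x, H (p t) x ∂μ = M := fun t => hM (p t)
  have h2 : ∀ t, MemLp (H t) 2 μ := fun t => (h4 t).mono_exponent (by norm_num)
  -- the conditional variances and second moments of the modified sequence
  have hlim' : ∀ᵐ ω ∂P, Tendsto (fun n => ∫ x, (H (p (θ n ω)) x - M) ^ 2 ∂μ) atTop (𝓝 v) := by
    filter_upwards [hlim, hpθ] with ω h1 h2'
    refine h1.congr' ?_
    filter_upwards [h2'] with n hn
    rw [hn, variance_eq_integral (h2 _).aestronglyMeasurable.aemeasurable, hM]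
  have hlimsq : ∀ᵐ ω ∂P, Tendsto (fun n => ∫ x, H (p (θ n ω)) x ^ 2 ∂μ) atTop
      (𝓝 (v + M ^ 2)) := by
    filter_upwards [hlim, hpθ] with ω h1 h2'
    refine (h1.add_const (M ^ 2)).congr' ?_
    filter_upwards [h2'] with n hn
    rw [hn, variance_eq_sub (h2 _), hM]
    simp
  have hmean : ∀ᵐ ω ∂P, Tendsto (fun n => adaptiveEstimator H θ X n ω) atTop (𝓝 M) := by
    -- the lemmas for uniformly bounded moments apply to `fun t x => H (p t) x`
    filter_upwards [hpθ, h.ae_tendsto_average_of_fourth_moment_le hG hG4 hC hGM] with ω h1 h3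
    simp only [adaptiveEstimator, one_div]
    exact tendsto_average_congr (h1.mono fun n hn => by rw [hn]) h3
  have hvar : ∀ᵐ ω ∂P, Tendsto (fun n => empiricalVariance H θ X n ω) atTop (𝓝 v) := by
    filter_upwards [hpθ, hmean, h.ae_tendsto_average_sq hG hG4 hC hlimsq] with ω h1 h3 h5
    have h6 := (tendsto_average_congr (u := fun i => H (θ i ω) (X (i + 1) ω) ^ 2)
      (h1.mono fun n hn => by simp only [hn]) h5).sub (h3.pow 2)
    rw [add_sub_cancel_right] at h6
    simpa only [empiricalVariance, one_div] using h6
  refine ⟨hvar, fun hv => ?_⟩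
  have hclt := h.tendstoInDistribution_of_fourth_moment_le hG hG4 hC hGM hv hlim'
  set Y : ℕ → Ω → ℝ := fun n ω => (√v)⁻¹ * ((√n)⁻¹ *
    ∑ i ∈ Finset.range n, (H (p (θ i ω)) (X (i + 1) ω) - M)) with hY
  set Q : ℕ → Ω → ℝ := fun n ω =>
    √(n : ℝ) / √(empiricalVariance H θ X n ω) * (adaptiveEstimator H θ X n ω - M) with hQ
  set c : ℕ → Ω → ℝ := fun n ω => √v / √(empiricalVariance H θ X n ω) with hc
  have hYm : ∀ n, Measurable (Y n) := fun n =>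
    ((Finset.measurable_fun_sum _ fun i _ =>
      (h.measurable_comp' hG i).sub_const M).const_mul _).const_mul _
  have hsm : ∀ n, Measurable fun ω => √(empiricalVariance H θ X n ω) := fun n =>
    (h.measurable_empiricalVariance hH n).sqrt
  have hcm : ∀ n, Measurable (c n) := fun n => (hsm n).const_div _
  have hQm : ∀ n, Measurable (Q n) := fun n =>
    ((hsm n).const_div _).mul ((h.measurable_adaptiveEstimator hH n).sub_const M)
  have hv0 : √v ≠ 0 := (Real.sqrt_pos.2 hv).ne'
  have hc1 : ∀ᵐ ω ∂P, Tendsto (fun n => c n ω) atTop (𝓝 1) := by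
    filter_upwards [hvar] with ω hω
    have := (tendsto_const_nhds (x := √v)).div hω.sqrt hv0
    rwa [div_self hv0] at this
  have hr0 : ∀ᵐ ω ∂P, Tendsto (fun n => Q n ω - c n ω * Y n ω) atTop (𝓝 0) := by
    filter_upwards [hvar, hpθ] with ω h1 h3
    have h5 := tendsto_inv_mul_sum_sub_sum (u := fun i => H (θ i ω) (X (i + 1) ω) - M)
      (w := fun i => H (p (θ i ω)) (X (i + 1) ω) - M) (h3.mono fun n hn => by simp only [hn])
      (Real.tendsto_sqrt_atTop.comp tendsto_natCast_atTop_atTop)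
    have h6 := (h1.sqrt.inv₀ hv0).mul h5
    rw [mul_zero] at h6
    refine h6.congr' ?_
    filter_upwards [eventually_gt_atTop 0] with n hn
    have hn0 : (0 : ℝ) < n := by exact_mod_cast hn
    have hq0 : √(n : ℝ) ≠ 0 := (Real.sqrt_pos.2 hn0).ne'
    have hq : √(n : ℝ) * ((1 / (n : ℝ)) * ∑ i ∈ Finset.range n, H (θ i ω) (X (i + 1) ω) - M) =
        (√(n : ℝ))⁻¹ * ∑ i ∈ Finset.range n, (H (θ i ω) (X (i + 1) ω) - M) := by
      rw [Finset.sum_sub_distrib, Finset.sum_const, Finset.card_range, nsmul_eq_mul]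
      have hq2 : √(n : ℝ) ^ 2 = n := Real.sq_sqrt hn0.le
      field_simp
      rw [hq2]
    simp only [hQ, hc, hY, Function.comp_apply, adaptiveEstimator]
    generalize √(empiricalVariance H θ X n ω) = σ
    rw [div_mul_eq_mul_div, hq]
    field_simp
  have := tendstoInDistribution_mul_add hclt hcm (fun n => (hQm n).sub ((hcm n).mul (hYm n)))
    hc1 hr0
  refine this.congr (fun n => ae_of_all _ fun ω => ?_) .rfl
  simp only [Pi.sub_apply, Pi.mul_apply]
  ring

end IsAdaptiveSampling

theorem corollary1 {d m : ℕ}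
    -- the random variable `Z` and the random vector `X`
    {Ω₀ : Type*} [MeasurableSpace Ω₀] (P₀ : Measure Ω₀) [IsProbabilityMeasure P₀]
    (Z : Ω₀ → ℝ) (hZ : Integrable Z P₀)
    (X : Ω₀ → EuclideanSpace ℝ (Fin m)) (hX : Measurable X)
    -- parametric representation of the mean of `Z`, with finite variances
    (H : EuclideanSpace ℝ (Fin d) → EuclideanSpace ℝ (Fin m) → ℝ)
    (hH : Measurable (Function.uncurry H))
    (hrep_int : ∀ t, Integrable (fun ω => H t (X ω)) P₀)
    (hrep : ∀ t, ∫ ω, Z ω ∂P₀ = ∫ ω, H t (X ω) ∂P₀)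
    (hvar : ∀ t, MemLp (fun ω => H t (X ω)) 2 P₀)
    -- the i.i.d. samples `Xs 1, Xs 2, …` following the law of `X`
    {Ω : Type*} [MeasurableSpace Ω] (P : Measure Ω) [IsProbabilityMeasure P]
    (Xs : ℕ → Ω → EuclideanSpace ℝ (Fin m)) (hXs : ∀ n, 1 ≤ n → Measurable (Xs n))
    (hindep : iIndepFun (fun n : ℕ => Xs (n + 1)) P)
    (hident : ∀ n, 1 ≤ n → IdentDistrib (Xs n) X P P₀)
    -- the adapted parameter sequence, converging a.s. to a deterministic limit
    (θ : ℕ → Ω → EuclideanSpace ℝ (Fin d)) (hθ : Adapted (sampleFiltration Xs hXs) θ)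
    (θlim : EuclideanSpace ℝ (Fin d))
    (hθlim : ∀ᵐ ω ∂P, Tendsto (fun n => θ n ω) atTop (𝓝 θlim))
    -- moment of order `4 + η`: finite everywhere and continuous at the limit
    (η : ℝ) (hη : 0 < η)
    (hs_fin : ∀ t, Integrable (fun ω => |H t (X ω)| ^ (4 + η)) P₀)
    (hs_cont : ContinuousAt (paramAbsMoment H X P₀ (4 + η)) θlim)
    -- continuity of the variance at the limit
    (hv_cont : ContinuousAt (paramVariance H X P₀) θlim) :
    (∀ᵐ ω ∂P, Tendsto (fun n => empiricalVariance H θ Xs n ω) atTop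
        (𝓝 (paramVariance H X P₀ θlim))) ∧
    (0 < paramVariance H X P₀ θlim →
      TendstoInDistribution
        (fun (n : ℕ) (ω : Ω) => √(n : ℝ) / √(empiricalVariance H θ Xs n ω) *
          (adaptiveEstimator H θ Xs n ω - ∫ ω', Z ω' ∂P₀))
        atTop (id : ℝ → ℝ) (fun _ => P) (gaussianReal 0 1)) := by
  classical
  set μ : Measure (EuclideanSpace ℝ (Fin m)) := P₀.map X with hμ
  have : IsProbabilityMeasure μ := Measure.isProbabilityMeasure_map hX.aemeasurable
  have hHt : ∀ t, Measurable (H t) := fun t => hH.of_uncurry_left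
  have h := isAdaptiveSampling_sampleFiltration hXs hindep
    (fun n => (hident (n + 1) (by omega)).map_eq) hθ
  -- moments of `H t` under the law of `X`
  have hq : (0 : ℝ) < 4 + η := by linarith
  have hHq : ∀ t, Integrable (fun x => |H t x| ^ (4 + η)) μ := fun t =>
    (integrable_map_measure ((hHt t).norm.pow_const _).aestronglyMeasurable hX.aemeasurable).2
      (hs_fin t)
  have hmom : ∀ t, paramAbsMoment H X P₀ (4 + η) t = ∫ x, |H t x| ^ (4 + η) ∂μ := fun t =>
    (integral_map hX.aemeasurable ((hHt t).norm.pow_const _).aestronglyMeasurable).symm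
  have h4 : ∀ t, MemLp (H t) 4 μ := by
    intro t
    have hLp : MemLp (H t) (ENNReal.ofReal (4 + η)) μ := by
      rw [← integrable_norm_rpow_iff (hHt t).aestronglyMeasurable
        (by simpa using hq) ENNReal.ofReal_ne_top, ENNReal.toReal_ofReal hq.le]
      exact hHq t
    refine hLp.mono_exponent ?_
    rw [show (4 : ENNReal) = ENNReal.ofReal 4 by simp]
    exact ENNReal.ofReal_le_ofReal (by linarith)
  have hM : ∀ t, ∫ x, H t x ∂μ = ∫ ω, Z ω ∂P₀ := fun t => by
    rw [hrep t, hμ, integral_map hX.aemeasurable (hHt t).aestronglyMeasurable]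
  have hv : ∀ t, paramVariance H X P₀ t = Var[H t; μ] := fun t =>
    (variance_map (hHt t).aemeasurable hX.aemeasurable).symm
  -- `p` sends parameters outside a small ball around `θlim` to `θlim`; on that ball the moments
  -- of order `4 + η` are bounded by `K`
  set K : ℝ := paramAbsMoment H X P₀ (4 + η) θlim + 1
  obtain ⟨δ, hδ, hball⟩ := Metric.eventually_nhds_iff_ball.1
    (hs_cont.eventually (gt_mem_nhds (lt_add_one _)))
  let p : EuclideanSpace ℝ (Fin d) → EuclideanSpace ℝ (Fin d) :=
    (Metric.ball θlim δ).piecewise id fun _ => θlim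
  have hp : Measurable p := measurable_id.piecewise measurableSet_ball measurable_const
  have hpball : ∀ t, p t ∈ Metric.ball θlim δ := by
    intro t
    by_cases ht : t ∈ Metric.ball θlim δ
    · simpa [p, Set.piecewise_eq_of_mem _ _ _ ht] using ht
    · simpa [p, Set.piecewise_eq_of_notMem _ _ _ ht] using hδ
  have hC : ∀ t, ∫ x, H (p t) x ^ 4 ∂μ ≤ 1 + K := by
    intro t
    have hi : Integrable (fun x => H (p t) x ^ 4) μ := by
      simpa [Even.pow_abs (by decide : Even 4)] using
        (h4 (p t)).integrable_norm_pow (p := 4) (by norm_num)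
    calc ∫ x, H (p t) x ^ 4 ∂μ ≤ ∫ x, (1 + |H (p t) x| ^ (4 + η)) ∂μ := by
          refine integral_mono hi ((integrable_const _).add (hHq _)) fun x => ?_
          simp only
          rw [← Even.pow_abs (by decide : Even 4)]
          have h0 := abs_nonneg (H (p t) x)
          rcases le_total |H (p t) x| 1 with hy | hy
          · have := pow_le_one₀ (n := 4) h0 hy
            have := Real.rpow_nonneg h0 (4 + η)
            linarith
          · have h5 : |H (p t) x| ^ 4 ≤ |H (p t) x| ^ (4 + η) := by
              rw [← Real.rpow_natCast]
              exact Real.rpow_le_rpow_of_exponent_le hy (by push_cast; linarith)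
            exact h5.trans (le_add_of_nonneg_left zero_le_one)
      _ = 1 + paramAbsMoment H X P₀ (4 + η) (p t) := by
          rw [integral_add (integrable_const _) (hHq _), hmom]; simp
      _ ≤ 1 + K := by gcongr; exact (hball _ (hpball t)).le
  have hpθ : ∀ᵐ ω ∂P, ∀ᶠ n in atTop, p (θ n ω) = θ n ω := by
    filter_upwards [hθlim] with ω hω
    filter_upwards [hω.eventually (Metric.ball_mem_nhds θlim hδ)] with n hn
    exact Set.piecewise_eq_of_mem _ _ _ hn
  have hlim : ∀ᵐ ω ∂P, Tendsto (fun n => Var[H (θ n ω); μ]) atTop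
      (𝓝 (paramVariance H X P₀ θlim)) := by
    filter_upwards [hθlim] with ω hω
    simpa only [hv] using hv_cont.tendsto.comp hω |>.congr fun n => hv _
  exact h.tendsto_empiricalVariance_and_tendstoInDistribution hH h4 hM hp hC hpθ hlim
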